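/- **Theorem (strong duality of $L^\varphi_{\mathrm{FK}}$).** Linear rational arithmetic (LRA) has terms $t ::= x \mid c \mid t_1+t_2 \mid c\cdot t$ with $c\in\mathbb{Q}$, atomic formulas $t_1<t_2$ and $t_1\le t_2$, and is interpreted over $\mathbb{Q}$. A formula is in prenex normal form if it is $\mathcal{Q}_1x_1\dots\mathcal{Q}_kx_k.\,\vartheta$ with $\mathcal{Q}_i\in\{\forall,\exists\}$ and $\vartheta$ quantifier-free (a Boolean combination of atomic formulas). *Skeletons.* SAT skeletons and UNSAT skeletons are generated by $$\pi ::= \bullet \mid \forall y.\pi \mid \textstyle\bigsqcup_{i=1,\dots,n} t_i.\pi_i, \qquad \varrho ::= \bullet \mid \exists y.\varrho \mid \textstyle\bigsqcap_{i=1,\dots,n} t_i.\varrho_i \qquad (n\ge 1),$$ where the $t_i$ are pairwise distinct LRA terms. The relation $\vec x\vdash\psi\lhd\pi$ ("$\pi$ is a SAT skeleton for the prenex formula $\psi$, with free variables among $\vec x$") is defined by: $\vec x\vdash\vartheta\lhd\bullet$ for $\vartheta$ quantifier-free; $\vec x\vdash(\forall y.\psi)\lhd(\forall y.\pi)$ if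 $\vec x,y\vdash\psi\lhd\pi$; and $\vec x\vdash(\exists y.\psi)\lhd\bigsqcup_i t_i.\pi_i$ if for every $i$ the variables of $t_i$ are among $\vec x$ and $\vec x\vdash\psi\lhd\pi_i$. Dually, $\vec x\vdash\bullet\rhd\vartheta$ for $\vartheta$ quantifier-free; $\vec x\vdash(\exists y.\varrho)\rhd(\exists y.\psi)$ if $\vec x,y\vdash\varrho\rhd\psi$; and $\vec x\vdash(\bigsqcap_i t_i.\varrho_i)\rhd(\forall y.\psi)$ if for every $i$ the variables of $t_i$ are among $\vec x$ and $\vec x\vdash\varrho_i\rhd\psi$. For a closed prenex formula $\varphi$ put $\mathrm{SAT}(\varphi)=\{\pi\mid{}\vdash\varphi\lhd\pi\}$ and $\mathrm{UNSAT}(\varphi)=\{\varrho\mid{}\vdash\varrho\rhd\varphi\}$. *Lagrangian.* A pair $(\varrho,\pi)\in\mathrm{UNSAT}(\varphi)\times\mathrm{SAT}(\varphi)$ induces the closed quantifier-free formula $\langle\varrho\,|\,\varphi\,|\,\pi\rangle$ given by $$\langle\bullet\,|\,\vartheta\,|\,\bullet\rangle:=\vartheta,\qquad \langle\textstyle\bigsqcap_i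 t_i.\varrho_i\,|\,\forall x.\varphi\,|\,\forall x.\pi\rangle:=\bigwedge_i\langle\varrho_i\,|\,\varphi[t_i/x]\,|\,\pi[t_i/x]\rangle,$$ $$\langle\exists x.\varrho\,|\,\exists x.\varphi\,|\,\textstyle\bigsqcup_i t_i.\pi_i\rangle:=\bigvee_i\langle\varrho[t_i/x]\,|\,\varphi[t_i/x]\,|\,\pi_i\rangle,$$ where a substitution $[t_i/x]$ into a skeleton is carried out termwise (terms that become equal are not merged). The Farzan–Kincaid Lagrangian $L^\varphi_{\mathrm{FK}}\colon\mathrm{UNSAT}(\varphi)\times\mathrm{SAT}(\varphi)\to\{-1,1\}$ takes the value $1$ at $(\varrho,\pi)$ if $\langle\varrho\,|\,\varphi\,|\,\pi\rangle$ is true, and $-1$ otherwise. *Claim.* For every closed prenex LRA formula $\varphi$, the Lagrangian $L^\varphi_{\mathrm{FK}}$ enjoys strong duality, $$\sup_{\pi\in\mathrm{SAT}(\varphi)}\ \inf_{\varrho\in\mathrm{UNSAT}(\varphi)}L^\varphi_{\mathrm{FK}}(\varrho,\pi)\;=\;\inf_{\varrho\in\mathrm{UNSAT}(\varphi)}\ \sup_{\pi\in\mathrm{SAT}(\varphi)}L^\varphi_{\mathrm{FK}}(\varrho,\pi),$$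 and this common optimal value is $1$ if $\varphi$ is valid (true over $\mathbb{Q}$) and $-1$ otherwise. -/

import Mathlib

/-! ### Lagrangians -/

section Lagrangian

variable {X Y P : Type*} [CompleteLinearOrder P]

/-- The optimal value `inf_x sup_y L(x, y)` of the primal problem of a Lagrangian
`L : X × Y → P`, with values in a totally ordered complete lattice `P`. -/
def primalValue (L : X × Y → P) : P := ⨅ x : X, ⨆ y : Y, L (x, y)

/-- The optimal value `sup_y inf_x L(x, y)` of the dual problem. -/
def dualValue (L : X × Y → P) : P := ⨆ y : Y, ⨅ x : X, L (x, y)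

/-- Strong duality: `sup_y inf_x L(x, y) = inf_x sup_y L(x, y)`. -/
def StrongDuality (L : X × Y → P) : Prop := dualValue L = primalValue L

end Lagrangian

/-- The two-element set `{-1, 1}`, with the order inherited from the integers. -/
abbrev SignValue : Type := {z : ℤ // z = -1 ∨ z = 1}

namespace SignValue

/-- The value `-1`. -/
def neg : SignValue := ⟨-1, Or.inl rfl⟩

/-- The value `1`. -/
def pos : SignValue := ⟨1, Or.inr rfl⟩

instance : Finite SignValue :=
  Set.Finite.to_subtype (Set.toFinite ({-1, 1} : Set ℤ))

instance : BoundedOrder SignValue where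
  top := pos
  le_top := by
    rintro ⟨z, rfl | rfl⟩
    · exact Subtype.mk_le_mk.2 (by norm_num)
    · exact le_refl _
  bot := neg
  bot_le := by
    rintro ⟨z, rfl | rfl⟩
    · exact le_refl _
    · exact Subtype.mk_le_mk.2 (by norm_num)

/-- A finite bounded linear order is a complete linear order. -/
noncomputable instance : CompleteLinearOrder SignValue :=
  letI : Fintype SignValue := Fintype.ofFinite SignValue
  Fintype.toCompleteLinearOrder SignValue

open Classical in
/-- The value `1` if `p` is true, and `-1` if `p` is false. -/
noncomputable def ofProp (p : Prop) : SignValue := if p then pos else neg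

end SignValue

/-! ### Linear rational arithmetic

Variables are well-scoped de Bruijn indices: `Term n`, `QFFormula n` and `Prenex q n` are terms
and formulas with free variables among `x₀, …, xₙ₋₁`.  Under a quantifier the bound variable is
`x₀` and the index of every other variable is increased by one.  Thus formulas are taken up to
renaming of bound variables, substitution is capture-avoiding, and `n = 0` means closed. -/

namespace LRA

/-- Terms `t ::= x ∣ c ∣ t₁ + t₂ ∣ c · t`, where `c ∈ ℚ`. -/
inductive Term (n : ℕ) : Type
  | var (i : Fin n) : Term n
  | const (c : ℚ) : Term n
  | add (t₁ t₂ : Term n) : Term n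
  | smul (c : ℚ) (t : Term n) : Term n

namespace Term

/-- The value of a term under an assignment of rational numbers to its variables. -/
def eval {n : ℕ} (v : Fin n → ℚ) : Term n → ℚ
  | var i => v i
  | const c => c
  | add t₁ t₂ => t₁.eval v + t₂.eval v
  | smul c t => c * t.eval v

/-- Simultaneous substitution of terms for the variables of a term. -/
def subst {n m : ℕ} (σ : Fin n → Term m) : Term n → Term m
  | var i => σ i
  | const c => const c
  | add t₁ t₂ => add (t₁.subst σ) (t₂.subst σ)
  | smul c t => smul c (t.subst σ)

/-- The substitution acting under a binder: the bound variable is kept, and the other variables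
are replaced as `σ` prescribes. -/
def lift {n m : ℕ} (σ : Fin n → Term m) : Fin (n + 1) → Term (m + 1) :=
  Fin.cons (var 0) fun i => (σ i).subst fun j => var j.succ

/-- The substitution `[t/x₀]`, which sends `x₀` to `t` and keeps the other variables. -/
def single {n : ℕ} (t : Term n) : Fin (n + 1) → Term n :=
  Fin.cons t var

end Term

/-- Quantifier-free formulas: Boolean combinations of the atoms `t₁ < t₂` and `t₁ ≤ t₂`. -/
inductive QFFormula (n : ℕ) : Type
  | lt (t₁ t₂ : Term n) : QFFormula n
  | le (t₁ t₂ : Term n) : QFFormula n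
  | verum : QFFormula n
  | falsum : QFFormula n
  | not (θ : QFFormula n) : QFFormula n
  | and (θ₁ θ₂ : QFFormula n) : QFFormula n
  | or (θ₁ θ₂ : QFFormula n) : QFFormula n

namespace QFFormula

/-- Truth of a quantifier-free formula over `ℚ` under an assignment. -/
def Holds {n : ℕ} (v : Fin n → ℚ) : QFFormula n → Prop
  | lt t₁ t₂ => t₁.eval v < t₂.eval v
  | le t₁ t₂ => t₁.eval v ≤ t₂.eval v
  | verum => True
  | falsum => False
  | not θ => ¬ θ.Holds v
  | and θ₁ θ₂ => θ₁.Holds v ∧ θ₂.Holds v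
  | or θ₁ θ₂ => θ₁.Holds v ∨ θ₂.Holds v

/-- Simultaneous substitution in a quantifier-free formula. -/
def subst {n m : ℕ} (σ : Fin n → Term m) : QFFormula n → QFFormula m
  | lt t₁ t₂ => lt (t₁.subst σ) (t₂.subst σ)
  | le t₁ t₂ => le (t₁.subst σ) (t₂.subst σ)
  | verum => verum
  | falsum => falsum
  | not θ => not (θ.subst σ)
  | and θ₁ θ₂ => and (θ₁.subst σ) (θ₂.subst σ)
  | or θ₁ θ₂ => or (θ₁.subst σ) (θ₂.subst σ)

/-- The finite conjunction `⋀ᵢ θᵢ`. -/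
def bigAnd {n k : ℕ} (θ : Fin k → QFFormula n) : QFFormula n :=
  (List.ofFn θ).foldr and verum

/-- The finite disjunction `⋁ᵢ θᵢ`. -/
def bigOr {n k : ℕ} (θ : Fin k → QFFormula n) : QFFormula n :=
  (List.ofFn θ).foldr or falsum

end QFFormula

/-- The two quantifiers. -/
inductive Quantifier : Type
  | all
  | ex

/-- `Prenex q n` is the type of formulas `Q₁ y₁. … Q_k y_k. θ` in prenex normal form, with
quantifier prefix `q = [Q₁, …, Q_k]`, quantifier-free `θ`, and `n` free variables.  The closed
formulas are the elements of `Prenex q 0`, for all prefixes `q`. -/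
inductive Prenex : List Quantifier → ℕ → Type
  | qf {n : ℕ} (θ : QFFormula n) : Prenex [] n
  | all {q : List Quantifier} {n : ℕ} (ψ : Prenex q (n + 1)) : Prenex (.all :: q) n
  | ex {q : List Quantifier} {n : ℕ} (ψ : Prenex q (n + 1)) : Prenex (.ex :: q) n

namespace Prenex

/-- Truth of a prenex formula over `ℚ` under an assignment. -/
def Holds : {q : List Quantifier} → {n : ℕ} → (Fin n → ℚ) → Prenex q n → Prop
  | _, _, v, qf θ => θ.Holds v
  | _, _, v, all ψ => ∀ r : ℚ, ψ.Holds (Fin.cons r v)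
  | _, _, v, ex ψ => ∃ r : ℚ, ψ.Holds (Fin.cons r v)

/-- Simultaneous capture-avoiding substitution in a prenex formula. -/
def subst : {q : List Quantifier} → {n m : ℕ} → (Fin n → Term m) → Prenex q n → Prenex q m
  | _, _, _, σ, qf θ => qf (θ.subst σ)
  | _, _, _, σ, all ψ => all (ψ.subst (Term.lift σ))
  | _, _, _, σ, ex ψ => ex (ψ.subst (Term.lift σ))

/-- Validity of a closed prenex formula: truth over `ℚ`. -/
def Valid {q : List Quantifier} (φ : Prenex q 0) : Prop := φ.Holds Fin.elim0

end Prenex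

/-! ### Strategy skeletons

Whether a skeleton is one for a given prenex formula depends only on the quantifier prefix of the
formula, so skeletons are indexed by the prefix; the second index `m` bounds the free variables of
the skeleton. -/

/-- Skeletons `π ::= • ∣ ∀ y. π ∣ ⨆_{i=1,…,k} tᵢ.πᵢ` with `k ≥ 1`, shaped as the formulas with
prefix `q`, with `m` free variables.  In `∀ y. π` the variable `y` is available to `π`; in `choice`,
the terms `tᵢ` and the skeletons `πᵢ` use the same variables as the whole skeleton.
That the `tᵢ` are pairwise distinct is imposed by `SatTree.Distinct`; it is not part of the tree
because it need not survive a substitution. -/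
inductive SatTree : List Quantifier → ℕ → Type
  | leaf {m : ℕ} : SatTree [] m
  | all {q : List Quantifier} {m : ℕ} (π : SatTree q (m + 1)) : SatTree (.all :: q) m
  | choice {q : List Quantifier} {m : ℕ} (k : ℕ) (t : Fin (k + 1) → Term m)
      (π : Fin (k + 1) → SatTree q m) : SatTree (.ex :: q) m

namespace SatTree

/-- At every `⨆ᵢ tᵢ.πᵢ` the terms `tᵢ` are pairwise (syntactically) distinct. -/
def Distinct : {q : List Quantifier} → {m : ℕ} → SatTree q m → Prop
  | _, _, leaf => True
  | _, _, all π => π.Distinct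
  | _, _, choice _ t π => Function.Injective t ∧ ∀ i, (π i).Distinct

/-- Simultaneous substitution in the terms of a skeleton. -/
def subst : {q : List Quantifier} → {n m : ℕ} → (Fin n → Term m) → SatTree q n → SatTree q m
  | _, _, _, _, leaf => leaf
  | _, _, _, σ, all π => all (π.subst (Term.lift σ))
  | _, _, _, σ, choice k t π => choice k (fun i => (t i).subst σ) fun i => (π i).subst σ

end SatTree

/-- Skeletons `ρ ::= • ∣ ∃ y. ρ ∣ ⨅_{i=1,…,k} tᵢ.ρᵢ` with `k ≥ 1`; the dual of `SatTree`. -/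
inductive UnsatTree : List Quantifier → ℕ → Type
  | leaf {m : ℕ} : UnsatTree [] m
  | ex {q : List Quantifier} {m : ℕ} (ρ : UnsatTree q (m + 1)) : UnsatTree (.ex :: q) m
  | choice {q : List Quantifier} {m : ℕ} (k : ℕ) (t : Fin (k + 1) → Term m)
      (ρ : Fin (k + 1) → UnsatTree q m) : UnsatTree (.all :: q) m

namespace UnsatTree

/-- At every `⨅ᵢ tᵢ.ρᵢ` the terms `tᵢ` are pairwise (syntactically) distinct. -/
def Distinct : {q : List Quantifier} → {m : ℕ} → UnsatTree q m → Prop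
  | _, _, leaf => True
  | _, _, ex ρ => ρ.Distinct
  | _, _, choice _ t ρ => Function.Injective t ∧ ∀ i, (ρ i).Distinct

/-- Simultaneous substitution in the terms of a skeleton. -/
def subst : {q : List Quantifier} → {n m : ℕ} → (Fin n → Term m) → UnsatTree q n → UnsatTree q m
  | _, _, _, _, leaf => leaf
  | _, _, _, σ, ex ρ => ex (ρ.subst (Term.lift σ))
  | _, _, _, σ, choice k t ρ => choice k (fun i => (t i).subst σ) fun i => (ρ i).subst σ

end UnsatTree

/-- The set `SAT(φ)` of SAT strategy skeletons for a closed formula `φ`. -/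
abbrev SatSkeleton {q : List Quantifier} (_φ : Prenex q 0) : Type :=
  {π : SatTree q 0 // π.Distinct}

/-- The set `UNSAT(φ)` of UNSAT strategy skeletons for a closed formula `φ`. -/
abbrev UnsatSkeleton {q : List Quantifier} (_φ : Prenex q 0) : Type :=
  {ρ : UnsatTree q 0 // ρ.Distinct}

/-- The closed quantifier-free formula `⟨ρ | φ | π⟩`. -/
def pairing : {q : List Quantifier} → UnsatTree q 0 → Prenex q 0 → SatTree q 0 → QFFormula 0
  | [], .leaf, .qf θ, .leaf => θ
  | .all :: _, .choice _ t ρ, .all ψ, .all π =>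
      QFFormula.bigAnd fun i =>
        pairing (ρ i) (ψ.subst (Term.single (t i))) (π.subst (Term.single (t i)))
  | .ex :: _, .ex ρ, .ex ψ, .choice _ t π =>
      QFFormula.bigOr fun i =>
        pairing (ρ.subst (Term.single (t i))) (ψ.subst (Term.single (t i))) (π i)

/-- The Farzan–Kincaid Lagrangian `L_FK^φ : UNSAT(φ) × SAT(φ) → {-1, 1}`, with
`L_FK^φ(ρ, π) = 1` if and only if `⟨ρ | φ | π⟩` is true. -/
noncomputable def lagrangianFK {q : List Quantifier} (φ : Prenex q 0) :
    UnsatSkeleton φ × SatSkeleton φ → SignValue :=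
  fun x => SignValue.ofProp ((pairing x.1.1 φ x.2.1).Holds Fin.elim0)

end LRA

/-! Each sign is forced by a single skeleton. If the formula is true, some SAT skeleton makes the
pairing true against every UNSAT skeleton, so the dual value is the top; if it is false, some UNSAT
skeleton does the dual, so the primal value is the bottom. Weak duality then fixes the other value.

Such skeletons exist because finitely many terms, chosen uniformly in the free variables, suffice as
witnesses for an existential quantifier. For a quantifier-free matrix, each atom compares two affine
functions of the bound variable, so its truth depends only on the position of that variable relative
to one root, itself a term in the other variables (`Term.exists_root`). Midpoints of roots, roots
shifted by one, and zero meet every possible position (`exists_sameSide`). Substituting these test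
terms eliminates the quantifier, so every prenex formula has a quantifier-free equivalent
(`Prenex.exists_qf`), and the test terms of that equivalent serve as witnesses, or as
counterexamples after negation. Recursion on the prefix assembles them into a winning skeleton. -/

namespace LRA

/-! ### Substitution -/

namespace Term

variable {n m k : ℕ}

@[simp]
theorem eval_subst (σ : Fin n → Term m) (v : Fin m → ℚ) (t : Term n) :
    (t.subst σ).eval v = t.eval fun i => (σ i).eval v := by
  induction t with
  | var i => rfl
  | const c => rfl
  | add t₁ t₂ h₁ h₂ => simp [subst, eval, h₁, h₂]
  | smul c t h => simp [subst, eval, h]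

theorem subst_subst (σ : Fin n → Term m) (τ : Fin m → Term k) (t : Term n) :
    (t.subst σ).subst τ = t.subst fun i => (σ i).subst τ := by
  induction t with
  | var i => rfl
  | const c => rfl
  | add t₁ t₂ h₁ h₂ => simp [subst, h₁, h₂]
  | smul c t h => simp [subst, h]

theorem subst_var (t : Term n) : t.subst var = t := by
  induction t with
  | var i => rfl
  | const c => rfl
  | add t₁ t₂ h₁ h₂ => simp [subst, h₁, h₂]
  | smul c t h => simp [subst, h]

theorem lift_var : lift (var : Fin n → Term n) = var := by
  funext i
  cases i using Fin.cases <;> rfl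

theorem lift_comp (σ : Fin n → Term m) (τ : Fin m → Term k) :
    (fun i => (lift σ i).subst (lift τ)) = lift fun i => (σ i).subst τ := by
  funext i
  cases i using Fin.cases with
  | zero => rfl
  | succ i => simp [lift, subst_subst, subst]

/-- Instantiating the bound variable undoes the index shift that `lift` applied to the other
variables. -/
theorem lift_comp_single (σ : Fin n → Term m) (t : Term m) :
    (fun i => (lift σ i).subst (single t)) = (Fin.cons t σ : Fin (n + 1) → Term m) := by
  funext i
  cases i using Fin.cases with
  | zero => rfl
  | succ i => simp [lift, single, subst_subst, subst, subst_var]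

theorem single_comp (σ : Fin n → Term m) (t : Term n) :
    (fun i => (single t i).subst σ) = (Fin.cons (t.subst σ) σ : Fin (n + 1) → Term m) := by
  funext i
  cases i using Fin.cases <;> rfl

theorem eval_lift (σ : Fin n → Term m) (r : ℚ) (v : Fin m → ℚ) :
    (fun i => (lift σ i).eval (Fin.cons r v : Fin (m + 1) → ℚ)) =
      (Fin.cons r fun i => (σ i).eval v : Fin (n + 1) → ℚ) := by
  funext i
  cases i using Fin.cases with
  | zero => rfl
  | succ i => simp [lift, eval]

theorem eval_single (t : Term n) (v : Fin n → ℚ) :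
    (fun i => (single t i).eval v) = (Fin.cons (t.eval v) v : Fin (n + 1) → ℚ) := by
  funext i
  cases i using Fin.cases <;> rfl

theorem eval_cons (t : Term m) (σ : Fin n → Term m) (v : Fin m → ℚ) :
    (fun i => (Fin.cons t σ : Fin (n + 1) → Term m) i |>.eval v) =
      (Fin.cons (t.eval v) fun i => (σ i).eval v : Fin (n + 1) → ℚ) := by
  funext i
  cases i using Fin.cases <;> rfl

end Term

namespace QFFormula

variable {n m k : ℕ}

theorem holds_subst (σ : Fin n → Term m) (v : Fin m → ℚ) (θ : QFFormula n) :
    (θ.subst σ).Holds v ↔ θ.Holds fun i => (σ i).eval v := by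
  induction θ <;> simp_all [subst, Holds]

theorem subst_subst (σ : Fin n → Term m) (τ : Fin m → Term k) (θ : QFFormula n) :
    (θ.subst σ).subst τ = θ.subst fun i => (σ i).subst τ := by
  induction θ <;> simp_all [subst, Term.subst_subst]

theorem subst_var (θ : QFFormula n) : θ.subst Term.var = θ := by
  induction θ <;> simp_all [subst, Term.subst_var]

theorem holds_foldr_and (v : Fin n → ℚ) (l : List (QFFormula n)) :
    (l.foldr and verum).Holds v ↔ ∀ θ ∈ l, θ.Holds v := by
  induction l <;> simp_all [Holds]

theorem holds_foldr_or (v : Fin n → ℚ) (l : List (QFFormula n)) :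
    (l.foldr or falsum).Holds v ↔ ∃ θ ∈ l, θ.Holds v := by
  induction l <;> simp_all [Holds]

theorem holds_bigAnd (v : Fin n → ℚ) (θ : Fin k → QFFormula n) :
    (bigAnd θ).Holds v ↔ ∀ i, (θ i).Holds v := by
  simp [bigAnd, holds_foldr_and]

theorem holds_bigOr (v : Fin n → ℚ) (θ : Fin k → QFFormula n) :
    (bigOr θ).Holds v ↔ ∃ i, (θ i).Holds v := by
  simp [bigOr, holds_foldr_or]

end QFFormula

namespace Prenex

theorem holds_subst {q : List Quantifier} {n : ℕ} (ψ : Prenex q n) :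
    ∀ {m : ℕ} (σ : Fin n → Term m) (v : Fin m → ℚ),
      (ψ.subst σ).Holds v ↔ ψ.Holds fun i => (σ i).eval v := by
  induction ψ with
  | qf θ => intro m σ v; exact θ.holds_subst σ v
  | all ψ ih => intro m σ v; simp only [subst, Holds, ih, Term.eval_lift]
  | ex ψ ih => intro m σ v; simp only [subst, Holds, ih, Term.eval_lift]

theorem subst_subst {q : List Quantifier} {n : ℕ} (ψ : Prenex q n) :
    ∀ {m k : ℕ} (σ : Fin n → Term m) (τ : Fin m → Term k),
      (ψ.subst σ).subst τ = ψ.subst fun i => (σ i).subst τ := by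
  induction ψ with
  | qf θ => intro m k σ τ; simp only [subst, θ.subst_subst]
  | all ψ ih => intro m k σ τ; simp only [subst, ih, Term.lift_comp]
  | ex ψ ih => intro m k σ τ; simp only [subst, ih, Term.lift_comp]

theorem subst_var {q : List Quantifier} {n : ℕ} (ψ : Prenex q n) : ψ.subst Term.var = ψ := by
  induction ψ with
  | qf θ => simp only [subst, θ.subst_var]
  | all ψ ih => simp only [subst, Term.lift_var, ih]
  | ex ψ ih => simp only [subst, Term.lift_var, ih]

/-- Merges an instance of the body with the opponent's term into one closed substitution, the form
in which the induction hypotheses on winning skeletons apply. -/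
theorem subst_lift_single {q : List Quantifier} {n m : ℕ} (ψ : Prenex q (n + 1))
    (σ : Fin n → Term m) (t : Term m) :
    (ψ.subst (Term.lift σ)).subst (Term.single t) = ψ.subst (Fin.cons t σ) := by
  rw [subst_subst, Term.lift_comp_single]

/-- Read backwards, it splits off the player's own term, which is chosen before the outer variables
receive values. -/
theorem subst_single_subst {q : List Quantifier} {n m : ℕ} (ψ : Prenex q (n + 1))
    (σ : Fin n → Term m) (t : Term n) :
    (ψ.subst (Term.single t)).subst σ = ψ.subst (Fin.cons (t.subst σ) σ) := by
  rw [subst_subst, Term.single_comp]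

end Prenex

namespace SatTree

theorem subst_subst {q : List Quantifier} {n : ℕ} (π : SatTree q n) :
    ∀ {m k : ℕ} (σ : Fin n → Term m) (τ : Fin m → Term k),
      (π.subst σ).subst τ = π.subst fun i => (σ i).subst τ := by
  induction π with
  | leaf => intro m k σ τ; rfl
  | all π ih => intro m k σ τ; simp only [subst, ih, Term.lift_comp]
  | choice j t π ih => intro m k σ τ; simp only [subst, ih, Term.subst_subst]

theorem subst_var {q : List Quantifier} {n : ℕ} (π : SatTree q n) : π.subst Term.var = π := by
  induction π with
  | leaf => rfl
  | all π ih => simp only [subst, Term.lift_var, ih]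
  | choice j t π ih => simp only [subst, Term.subst_var, ih]

end SatTree

namespace UnsatTree

theorem subst_subst {q : List Quantifier} {n : ℕ} (ρ : UnsatTree q n) :
    ∀ {m k : ℕ} (σ : Fin n → Term m) (τ : Fin m → Term k),
      (ρ.subst σ).subst τ = ρ.subst fun i => (σ i).subst τ := by
  induction ρ with
  | leaf => intro m k σ τ; rfl
  | ex ρ ih => intro m k σ τ; simp only [subst, ih, Term.lift_comp]
  | choice j t ρ ih => intro m k σ τ; simp only [subst, ih, Term.subst_subst]

theorem subst_var {q : List Quantifier} {n : ℕ} (ρ : UnsatTree q n) : ρ.subst Term.var = ρ := by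
  induction ρ with
  | leaf => rfl
  | ex ρ ih => simp only [subst, Term.lift_var, ih]
  | choice j t ρ ih => simp only [subst, Term.subst_var, ih]

end UnsatTree

/-! ### Quantifier elimination by finitely many test terms -/

/-- Every term is an affine function of its first variable. -/
theorem Term.exists_affine {n : ℕ} (t : Term (n + 1)) :
    ∃ (a : ℚ) (s : Term n), ∀ (r : ℚ) (v : Fin n → ℚ),
      t.eval (Fin.cons r v : Fin (n + 1) → ℚ) = a * r + s.eval v := by
  induction t with
  | var i =>
    cases i using Fin.cases with
    | zero => exact ⟨1, .const 0, fun r v => by simp [eval]⟩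
    | succ i => exact ⟨0, .var i, fun r v => by simp [eval]⟩
  | const c => exact ⟨0, .const c, fun r v => by simp [eval]⟩
  | add t₁ t₂ h₁ h₂ =>
    obtain ⟨a₁, s₁, h₁⟩ := h₁
    obtain ⟨a₂, s₂, h₂⟩ := h₂
    exact ⟨a₁ + a₂, .add s₁ s₂, fun r v => by simp only [eval, h₁, h₂]; ring⟩
  | smul c t h =>
    obtain ⟨a, s, h⟩ := h
    exact ⟨c * a, .smul c s, fun r v => by simp only [eval, h]; ring⟩

/-- The rationals `x` and `y` lie on the same side of `r`. -/
def SameSide (r x y : ℚ) : Prop := (r < x ↔ r < y) ∧ (x < r ↔ y < r)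

/-- The order of the values of two terms is determined by the side of a single root on which the
first variable lies. -/
theorem Term.exists_root {n : ℕ} (t₁ t₂ : Term (n + 1)) :
    ∃ s : Term n, ∀ (v : Fin n → ℚ) (x y : ℚ), SameSide (s.eval v) x y →
      (t₁.eval (Fin.cons x v : Fin (n + 1) → ℚ) < t₂.eval (Fin.cons x v : Fin (n + 1) → ℚ) ↔
        t₁.eval (Fin.cons y v : Fin (n + 1) → ℚ) < t₂.eval (Fin.cons y v : Fin (n + 1) → ℚ)) ∧
      (t₁.eval (Fin.cons x v : Fin (n + 1) → ℚ) ≤ t₂.eval (Fin.cons x v : Fin (n + 1) → ℚ) ↔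
        t₁.eval (Fin.cons y v : Fin (n + 1) → ℚ) ≤ t₂.eval (Fin.cons y v : Fin (n + 1) → ℚ)) := by
  obtain ⟨a₁, s₁, h₁⟩ := t₁.exists_affine
  obtain ⟨a₂, s₂, h₂⟩ := t₂.exists_affine
  -- The solution of `a₁ * r + s₁ = a₂ * r + s₂`. For equal slopes the inverse is zero and the term
  -- is a dummy, since the comparison no longer involves the first variable.
  refine ⟨.smul (a₁ - a₂)⁻¹ (.add s₂ (.smul (-1) s₁)), fun v x y h => ?_⟩
  simp only [h₁, h₂]
  simp only [eval, SameSide] at h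
  set c := s₁.eval v
  set d := s₂.eval v
  obtain ha | ha | ha := lt_trichotomy a₁ a₂
  · have ha' : a₁ - a₂ < 0 := sub_neg.2 ha
    have lt_iff (z : ℚ) : a₁ * z + c < a₂ * z + d ↔ (a₁ - a₂)⁻¹ * (d + -1 * c) < z := by
      rw [inv_mul_eq_div, div_lt_iff_of_neg ha']
      constructor <;> intro h <;> linarith
    have gt_iff (z : ℚ) : a₂ * z + d < a₁ * z + c ↔ z < (a₁ - a₂)⁻¹ * (d + -1 * c) := by
      rw [inv_mul_eq_div, lt_div_iff_of_neg ha']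
      constructor <;> intro h <;> linarith
    exact ⟨by rw [lt_iff, lt_iff, h.1], by rw [← not_lt, ← not_lt, gt_iff, gt_iff, h.2]⟩
  · subst ha
    simp
  · have ha' : 0 < a₁ - a₂ := sub_pos.2 ha
    have lt_iff (z : ℚ) : a₁ * z + c < a₂ * z + d ↔ z < (a₁ - a₂)⁻¹ * (d + -1 * c) := by
      rw [inv_mul_eq_div, lt_div_iff₀ ha']
      constructor <;> intro h <;> linarith
    have gt_iff (z : ℚ) : a₂ * z + d < a₁ * z + c ↔ (a₁ - a₂)⁻¹ * (d + -1 * c) < z := by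
      rw [inv_mul_eq_div, div_lt_iff₀ ha']
      constructor <;> intro h <;> linarith
    exact ⟨by rw [lt_iff, lt_iff, h.2], by rw [← not_lt, ← not_lt, gt_iff, gt_iff, h.1]⟩

/-- The truth of a quantifier-free formula is determined by the sides of finitely many roots on
which the first variable lies. -/
theorem QFFormula.exists_roots {n : ℕ} (θ : QFFormula (n + 1)) :
    ∃ R : List (Term n), ∀ (v : Fin n → ℚ) (x y : ℚ), (∀ s ∈ R, SameSide (s.eval v) x y) →
      (θ.Holds (Fin.cons x v : Fin (n + 1) → ℚ) ↔ θ.Holds (Fin.cons y v : Fin (n + 1) → ℚ)) := by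
  induction θ with
  | lt t₁ t₂ =>
    obtain ⟨s, hs⟩ := t₁.exists_root t₂
    exact ⟨[s], fun v x y h => (hs v x y (h s (by simp))).1⟩
  | le t₁ t₂ =>
    obtain ⟨s, hs⟩ := t₁.exists_root t₂
    exact ⟨[s], fun v x y h => (hs v x y (h s (by simp))).2⟩
  | verum => exact ⟨[], fun v x y _ => Iff.rfl⟩
  | falsum => exact ⟨[], fun v x y _ => Iff.rfl⟩
  | not θ ih =>
    obtain ⟨R, hR⟩ := ih
    exact ⟨R, fun v x y h => not_congr (hR v x y h)⟩
  | and θ₁ θ₂ h₁ h₂ =>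
    obtain ⟨R₁, h₁⟩ := h₁
    obtain ⟨R₂, h₂⟩ := h₂
    exact ⟨R₁ ++ R₂, fun v x y h => and_congr
      (h₁ v x y fun s hs => h s (List.mem_append_left _ hs))
      (h₂ v x y fun s hs => h s (List.mem_append_right _ hs))⟩
  | or θ₁ θ₂ h₁ h₂ =>
    obtain ⟨R₁, h₁⟩ := h₁
    obtain ⟨R₂, h₂⟩ := h₂
    exact ⟨R₁ ++ R₂, fun v x y h => or_congr
      (h₁ v x y fun s hs => h s (List.mem_append_left _ hs))
      (h₂ v x y fun s hs => h s (List.mem_append_right _ hs))⟩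

/-- Midpoints of pairs of elements of `R`, and the elements of `R` moved by one, represent all
positions of a rational relative to `R`. -/
theorem exists_sameSide (R : Finset ℚ) (x : ℚ) :
    ∃ y : ℚ, (y = 0 ∨ (∃ a ∈ R, y = a + 1) ∨ (∃ a ∈ R, y = a + -1) ∨
      ∃ a ∈ R, ∃ b ∈ R, y = 1 / 2 * (a + b)) ∧ ∀ r ∈ R, SameSide r x y := by
  by_cases hx : x ∈ R
  -- A root is its own midpoint with itself.
  · exact ⟨x, .inr (.inr (.inr ⟨x, hx, x, hx, by ring⟩)), fun r _ => ⟨Iff.rfl, Iff.rfl⟩⟩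
  have lower (h : (R.filter (· < x)).Nonempty) : ∃ a ∈ R, a < x ∧ ∀ r ∈ R, r < x → r ≤ a := by
    have := Finset.mem_filter.1 (Finset.max'_mem _ h)
    exact ⟨_, this.1, this.2, fun r hr hrx =>
      Finset.le_max' _ _ (Finset.mem_filter.2 ⟨hr, hrx⟩)⟩
  have upper (h : (R.filter (x < ·)).Nonempty) : ∃ b ∈ R, x < b ∧ ∀ r ∈ R, x < r → b ≤ r := by
    have := Finset.mem_filter.1 (Finset.min'_mem _ h)
    exact ⟨_, this.1, this.2, fun r hr hrx =>
      Finset.min'_le _ _ (Finset.mem_filter.2 ⟨hr, hrx⟩)⟩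
  -- It suffices that every element of `R` below (above) `x` is below (above) `y`.
  have side {y : ℚ} (h₁ : ∀ r ∈ R, r < x → r < y) (h₂ : ∀ r ∈ R, x < r → y < r) :
      ∀ r ∈ R, SameSide r x y := fun r hr => by
    have hne : r ≠ x := fun h => hx (h ▸ hr)
    obtain h | h := lt_or_gt_of_ne hne
    · exact ⟨iff_of_true h (h₁ r hr h), iff_of_false h.not_gt (h₁ r hr h).not_gt⟩
    · exact ⟨iff_of_false h.not_gt (h₂ r hr h).not_gt, iff_of_true h (h₂ r hr h)⟩
  -- With neighbours on both sides the midpoint lies in the same gap as `x`; with only one, a unit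
  -- step leaves `R` behind; with none, any number works.
  by_cases hl : (R.filter (· < x)).Nonempty <;> by_cases hu : (R.filter (x < ·)).Nonempty
  · obtain ⟨a, haR, hax, ha⟩ := lower hl
    obtain ⟨b, hbR, hxb, hb⟩ := upper hu
    exact ⟨1 / 2 * (a + b), .inr (.inr (.inr ⟨a, haR, b, hbR, rfl⟩)),
      side (fun r hr h => by linarith [ha r hr h]) fun r hr h => by linarith [hb r hr h]⟩
  · obtain ⟨a, haR, hax, ha⟩ := lower hl
    exact ⟨a + 1, .inr (.inl ⟨a, haR, rfl⟩),
      side (fun r hr h => by linarith [ha r hr h])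
        fun r hr h => (hu ⟨r, Finset.mem_filter.2 ⟨hr, h⟩⟩).elim⟩
  · obtain ⟨b, hbR, hxb, hb⟩ := upper hu
    exact ⟨b + -1, .inr (.inr (.inl ⟨b, hbR, rfl⟩)),
      side (fun r hr h => (hl ⟨r, Finset.mem_filter.2 ⟨hr, h⟩⟩).elim)
        fun r hr h => by linarith [hb r hr h]⟩
  · exact ⟨0, .inl rfl, side (fun r hr h => (hl ⟨r, Finset.mem_filter.2 ⟨hr, h⟩⟩).elim)
      fun r hr h => (hu ⟨r, Finset.mem_filter.2 ⟨hr, h⟩⟩).elim⟩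

/-- The elements of a nonempty list, enumerated without repetition. -/
theorem _root_.List.exists_injective_enum {α : Type*} (l : List α) (hl : l ≠ []) :
    ∃ (k : ℕ) (t : Fin (k + 1) → α), Function.Injective t ∧ ∀ a ∈ l, ∃ i, t i = a := by
  classical
  have hne : l.dedup ≠ [] := by simpa using hl
  obtain ⟨k, hk⟩ := Nat.exists_eq_succ_of_ne_zero (mt List.length_eq_zero_iff.1 hne)
  refine ⟨k, fun i => l.dedup.get (i.cast hk.symm), fun i j h => ?_, fun a ha => ?_⟩
  · exact Fin.cast_injective _ (List.nodup_iff_injective_get.1 l.nodup_dedup h)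
  · obtain ⟨i, hi⟩ := List.mem_iff_get.1 (List.mem_dedup.2 ha)
    exact ⟨i.cast hk, hi⟩

/-- An existential quantifier over a quantifier-free formula ranges over finitely many terms. -/
theorem QFFormula.exists_test_terms {n : ℕ} (θ : QFFormula (n + 1)) :
    ∃ (k : ℕ) (t : Fin (k + 1) → Term n), Function.Injective t ∧ ∀ v : Fin n → ℚ,
      (∃ r : ℚ, θ.Holds (Fin.cons r v : Fin (n + 1) → ℚ)) →
        ∃ i, θ.Holds (Fin.cons ((t i).eval v) v : Fin (n + 1) → ℚ) := by
  obtain ⟨R, hR⟩ := θ.exists_roots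
  obtain ⟨k, t, ht, hmem⟩ := List.exists_injective_enum
    -- Term versions of the four kinds of points in `exists_sameSide`, written so that their values
    -- agree by `rfl`. The constant zero also keeps the list nonempty when there are no roots.
    (Term.const 0 :: (R.map (fun s => s.add (.const 1)) ++ (R.map (fun s => s.add (.const (-1))) ++
      R.flatMap fun s => R.map fun s' => .smul (1 / 2) (s.add s')))) (by simp)
  refine ⟨k, t, ht, fun v ⟨x, hx⟩ => ?_⟩
  obtain ⟨y, hy, hside⟩ := exists_sameSide (R.map (Term.eval v)).toFinset x
  have hθ : θ.Holds (Fin.cons y v : Fin (n + 1) → ℚ) :=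
    (hR v x y fun s hs => hside _ (by simpa using ⟨s, hs, rfl⟩)).1 hx
  suffices h : ∃ i, (t i).eval v = y by
    obtain ⟨i, rfl⟩ := h
    exact ⟨i, hθ⟩
  simp only [List.mem_toFinset, List.mem_map, exists_exists_and_eq_and] at hy
  obtain rfl | ⟨s, hs, rfl⟩ | ⟨s, hs, rfl⟩ | ⟨s, hs, s', hs', rfl⟩ := hy
  · obtain ⟨i, hi⟩ := hmem (.const 0) (by simp)
    exact ⟨i, by rw [hi]; rfl⟩
  · obtain ⟨i, hi⟩ := hmem (s.add (.const 1)) (by simp [hs])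
    exact ⟨i, by rw [hi]; rfl⟩
  · obtain ⟨i, hi⟩ := hmem (s.add (.const (-1))) (by simp [hs])
    exact ⟨i, by rw [hi]; rfl⟩
  · obtain ⟨i, hi⟩ := hmem (.smul (1 / 2) (s.add s')) (by simp [hs, hs'])
    exact ⟨i, by rw [hi]; rfl⟩

/-- Linear rational arithmetic has quantifier elimination for existential formulas. -/
theorem QFFormula.exists_elim {n : ℕ} (θ : QFFormula (n + 1)) :
    ∃ θ' : QFFormula n, ∀ v : Fin n → ℚ,
      θ'.Holds v ↔ ∃ r : ℚ, θ.Holds (Fin.cons r v : Fin (n + 1) → ℚ) := by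
  obtain ⟨k, t, -, ht⟩ := θ.exists_test_terms
  refine ⟨bigOr fun i => θ.subst (Term.single (t i)), fun v => ?_⟩
  simp only [holds_bigOr, holds_subst, Term.eval_single]
  exact ⟨fun ⟨i, hi⟩ => ⟨_, hi⟩, ht v⟩

/-- Every prenex formula is equivalent to a quantifier-free formula. -/
theorem Prenex.exists_qf {q : List Quantifier} {n : ℕ} (ψ : Prenex q n) :
    ∃ θ : QFFormula n, ∀ v, θ.Holds v ↔ ψ.Holds v := by
  induction ψ with
  | qf θ => exact ⟨θ, fun v => Iff.rfl⟩
  | all ψ ih =>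
    obtain ⟨θ, hθ⟩ := ih
    obtain ⟨θ', hθ'⟩ := θ.not.exists_elim
    refine ⟨θ'.not, fun v => ?_⟩
    simp [QFFormula.Holds, Holds, hθ', hθ]
  | ex ψ ih =>
    obtain ⟨θ, hθ⟩ := ih
    obtain ⟨θ', hθ'⟩ := θ.exists_elim
    refine ⟨θ', fun v => ?_⟩
    simp [Holds, hθ', hθ]

/-- Test terms depend only on the set a formula defines, so those of a quantifier-free equivalent
serve. The terms do not depend on `v`; only the successful index does. -/
theorem Prenex.exists_witness_terms {q : List Quantifier} {n : ℕ} (ψ : Prenex q (n + 1)) :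
    ∃ (k : ℕ) (t : Fin (k + 1) → Term n), Function.Injective t ∧ ∀ v : Fin n → ℚ,
      (∃ r : ℚ, ψ.Holds (Fin.cons r v : Fin (n + 1) → ℚ)) →
        ∃ i, ψ.Holds (Fin.cons ((t i).eval v) v : Fin (n + 1) → ℚ) := by
  obtain ⟨θ, hθ⟩ := ψ.exists_qf
  simpa only [hθ] using θ.exists_test_terms

theorem Prenex.exists_counterexample_terms {q : List Quantifier} {n : ℕ}
    (ψ : Prenex q (n + 1)) :
    ∃ (k : ℕ) (t : Fin (k + 1) → Term n), Function.Injective t ∧ ∀ v : Fin n → ℚ,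
      (∃ r : ℚ, ¬ ψ.Holds (Fin.cons r v : Fin (n + 1) → ℚ)) →
        ∃ i, ¬ ψ.Holds (Fin.cons ((t i).eval v) v : Fin (n + 1) → ℚ) := by
  obtain ⟨θ, hθ⟩ := ψ.exists_qf
  simpa only [QFFormula.Holds, hθ] using θ.not.exists_test_terms

/-! ### Winning skeletons -/

/-- A formula has a SAT skeleton that wins, against every UNSAT skeleton, at every closed instance
at which the formula is true. -/
theorem Prenex.exists_winning_satTree {q : List Quantifier} :
    ∀ {n : ℕ} (ψ : Prenex q n), ∃ π : SatTree q n, π.Distinct ∧ ∀ σ : Fin n → Term 0,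
      ψ.Holds (fun i => (σ i).eval Fin.elim0) → ∀ ρ : UnsatTree q 0,
        (pairing ρ (ψ.subst σ) (π.subst σ)).Holds Fin.elim0 := by
  induction q with
  | nil =>
    rintro n ⟨θ⟩
    refine ⟨.leaf, trivial, fun σ hσ ρ => ?_⟩
    cases ρ
    exact (θ.holds_subst σ _).2 hσ
  | cons Q q ih =>
    intro n ψ
    cases ψ with
    | all ψ =>
      obtain ⟨π, hπ, hwin⟩ := ih ψ
      refine ⟨.all π, hπ, fun σ hσ ρ => ?_⟩
      cases ρ with
      | choice k t ρ =>
        simp only [subst, SatTree.subst, pairing, QFFormula.holds_bigAnd, subst_lift_single,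
          SatTree.subst_subst, Term.lift_comp_single]
        intro i
        -- The opponent's closed term extends `σ` to the bound variable; this is why the claim
        -- quantifies over all closed substitutions.
        apply hwin
        rw [Term.eval_cons]
        exact hσ _
    | ex ψ =>
      obtain ⟨k, t, ht, hwit⟩ := ψ.exists_witness_terms
      -- The branch below `t i` may use only the outer variables, so the induction hypothesis is
      -- applied to the instance of the body rather than to the body.
      choose π hπ hwin using fun i => ih (ψ.subst (Term.single (t i)))
      refine ⟨.choice k t π, ⟨ht, hπ⟩, fun σ hσ ρ => ?_⟩
      cases ρ with
      | ex ρ =>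
        simp only [subst, SatTree.subst, pairing, QFFormula.holds_bigOr, subst_lift_single]
        obtain ⟨i, hi⟩ := hwit _ hσ
        refine ⟨i, ?_⟩
        rw [← subst_single_subst]
        apply hwin
        rwa [holds_subst, Term.eval_single]

/-- A formula has an UNSAT skeleton that wins, against every SAT skeleton, at every closed instance
at which the formula is false. -/
theorem Prenex.exists_winning_unsatTree {q : List Quantifier} :
    ∀ {n : ℕ} (ψ : Prenex q n), ∃ ρ : UnsatTree q n, ρ.Distinct ∧ ∀ σ : Fin n → Term 0,
      ¬ ψ.Holds (fun i => (σ i).eval Fin.elim0) → ∀ π : SatTree q 0,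
        ¬ (pairing (ρ.subst σ) (ψ.subst σ) π).Holds Fin.elim0 := by
  induction q with
  | nil =>
    rintro n ⟨θ⟩
    refine ⟨.leaf, trivial, fun σ hσ π => ?_⟩
    cases π
    exact mt (θ.holds_subst σ _).1 hσ
  | cons Q q ih =>
    intro n ψ
    cases ψ with
    | all ψ =>
      obtain ⟨k, t, ht, hwit⟩ := ψ.exists_counterexample_terms
      -- Dually, each candidate counterexample gets a skeleton refuting its own instance.
      choose ρ hρ hwin using fun i => ih (ψ.subst (Term.single (t i)))
      refine ⟨.choice k t ρ, ⟨ht, hρ⟩, fun σ hσ π => ?_⟩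
      cases π with
      | all π =>
        simp only [subst, UnsatTree.subst, pairing, QFFormula.holds_bigAnd, subst_lift_single,
          not_forall]
        obtain ⟨i, hi⟩ := hwit _ (not_forall.1 hσ)
        refine ⟨i, ?_⟩
        rw [← subst_single_subst]
        apply hwin
        rwa [holds_subst, Term.eval_single]
    | ex ψ =>
      obtain ⟨ρ, hρ, hwin⟩ := ih ψ
      refine ⟨.ex ρ, hρ, fun σ hσ π => ?_⟩
      cases π with
      | choice k t π =>
        simp only [subst, UnsatTree.subst, pairing, QFFormula.holds_bigOr, subst_lift_single,
          UnsatTree.subst_subst, Term.lift_comp_single, not_exists]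
        intro i
        apply hwin
        rw [Term.eval_cons]
        exact not_exists.1 hσ _

theorem Prenex.Valid.exists_satSkeleton {q : List Quantifier} {φ : Prenex q 0} (h : φ.Valid) :
    ∃ π : SatSkeleton φ, ∀ ρ : UnsatSkeleton φ, lagrangianFK φ (ρ, π) = ⊤ := by
  obtain ⟨π, hπ, hwin⟩ := φ.exists_winning_satTree
  refine ⟨⟨π, hπ⟩, fun ρ => if_pos ?_⟩
  -- A closed formula is its own instance under the identity substitution, and there is only one
  -- assignment to no variables.
  have := hwin Term.var ((congrArg (Prenex.Holds · φ) (Subsingleton.elim _ _)).mp h) ρ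
  rwa [φ.subst_var, π.subst_var] at this

theorem Prenex.exists_unsatSkeleton_of_not_valid {q : List Quantifier} {φ : Prenex q 0}
    (h : ¬ φ.Valid) :
    ∃ ρ : UnsatSkeleton φ, ∀ π : SatSkeleton φ, lagrangianFK φ (ρ, π) = ⊥ := by
  obtain ⟨ρ, hρ, hwin⟩ := φ.exists_winning_unsatTree
  refine ⟨⟨ρ, hρ⟩, fun π => if_neg ?_⟩
  have := hwin Term.var (mt (congrArg (Prenex.Holds · φ) (Subsingleton.elim _ _)).mp h) π
  rwa [φ.subst_var, ρ.subst_var] at this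

end LRA

/-! ### Strong duality -/

theorem dualValue_le_primalValue {X Y P : Type*} [CompleteLinearOrder P] (L : X × Y → P) :
    dualValue L ≤ primalValue L :=
  iSup_iInf_le_iInf_iSup fun y x => L (x, y)

theorem mainTheorem6 (q : List LRA.Quantifier) (φ : LRA.Prenex q 0) :
    StrongDuality (LRA.lagrangianFK φ) ∧
      primalValue (LRA.lagrangianFK φ) = SignValue.ofProp φ.Valid := by
  have hle := dualValue_le_primalValue (LRA.lagrangianFK φ)
  by_cases h : φ.Valid
  · obtain ⟨π, hπ⟩ := h.exists_satSkeleton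
    have hdual : dualValue (LRA.lagrangianFK φ) = ⊤ :=
      top_unique (le_iSup_of_le π (le_iInf fun ρ => (hπ ρ).ge))
    have hprimal : primalValue (LRA.lagrangianFK φ) = ⊤ := top_unique (hdual ▸ hle)
    exact ⟨hdual.trans hprimal.symm, hprimal.trans (if_pos h).symm⟩
  · obtain ⟨ρ, hρ⟩ := LRA.Prenex.exists_unsatSkeleton_of_not_valid h
    have hprimal : primalValue (LRA.lagrangianFK φ) = ⊥ :=
      bot_unique (iInf_le_of_le ρ (iSup_le fun π => (hρ π).le))
    have hdual : dualValue (LRA.lagrangianFK φ) = ⊥ := bot_unique (hprimal ▸ hle)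
    exact ⟨hdual.trans hprimal.symm, hprimal.trans (if_neg h).symm⟩
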